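/- **Setting.** Let $\mathcal A$ be a finite nonempty action set, let $\mathcal X_A,\mathcal X_B,\mathcal Y$ be standard Borel spaces, and let $P$ be a (common prior) probability distribution of $(x_A,x_B,y)\in\mathcal X_A\times\mathcal X_B\times\mathcal Y$. Alice has a measurable utility $u_A:\mathcal A\times\mathcal Y\to[0,1]$, and each of $k$ Bobs has a measurable utility $U_i:\mathcal A\times\mathcal Y\to[0,1]$. The message space $M$ is a measurable space containing $[0,1]^{\mathcal A}$ (through a measurable embedding). A conversation has $K\ge 1$ rounds. In each round Alice, who knows $x_A$ and all $k$ transcripts so far, sends a message to each Bob; then, independently for each $i$, Bob $i$, who knows $x_B$ and his private transcript with Alice (including her current message), draws a reply from a distribution on $M$ given by his conversation rule $C_{B_i}$ (for each round, a Markov kernel from these data to $M$). After $K$ rounds Alice, who knows $x_A$ and the full transcript $\vec\pi$, draws an action $a\in\mathcal A$. The Bobs first commit to $\vec C_B=(C_{B_1},\dots,C_{B_k})$. Alice is committed to: - the *straightforward conversation rule*: in every round she sends to every Bob her current belief vector $(\mathbb E[u_A(a,y)\mid x_A,\vec\pi])_{a\in\mathcal A}$, where $\vec\pi$ is the transcript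 so far and the expectation is under the law induced by $P$, $\vec C_B$ and her own rule; - *$\lambda$-quantal response*, $\lambda>0$: with final belief vector $\mu_a=\mathbb E[u_A(a,y)\mid x_A,\vec\pi]$, she plays $a$ with probability $e^{\lambda\mu_a}/\sum_{a'}e^{\lambda\mu_{a'}}$. Let $\mathcal I^Q(\vec C_B)$ be the resulting distribution of $(a,y)$. The profile $\vec C_B$ is a *Quantal Response Nash Equilibrium* if for every $i$ and every conversation rule $C'$ of Bob $i$, $$\mathbb E_{\mathcal I^Q(\vec C_B)}[U_i(a,y)]\ \ge\ \mathbb E_{\mathcal I^Q(C',\vec C_{B,-i})}[U_i(a,y)].$$ The Bobs are *$\varepsilon$-weighted aligned* if there are weights $w_i\ge 0$ with $\sum_i w_i=1$ and $c\in\mathbb R$ such that $\left|\sum_i w_iU_i(a,y)+c-u_A(a,y)\right|\le\varepsilon$ for all $a\in\mathcal A$, $y\in\mathcal Y$. The prior satisfies *Information Substitutes* if, for every $a\in\mathcal A$ and all measurable $S\subseteq\mathcal X_A$, $T\subseteq\mathcal X_B$ with $P(x_A\in S,x_B\in T)>0$, writing $u=u_A(a,y)$ and $\mathbb E_{S,T}=\mathbb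 E[\,\cdot\mid x_A\in S,x_B\in T]$, $$\mathbb E_{S,T}\big[(u-\mathbb E[u\mid x_A\in S,x_B])^2\big]-\mathbb E_{S,T}\big[(u-\mathbb E[u\mid x_A,x_B])^2\big]\ \le\ \mathbb E_{S,T}\big[(u-\mathbb E[u\mid x_A\in S,x_B\in T])^2\big]-\mathbb E_{S,T}\big[(u-\mathbb E[u\mid x_A,x_B\in T])^2\big].$$ Finally, let $OPT=\mathbb E\big[\max_{a\in\mathcal A}\mathbb E[u_A(a,y)\mid x_A,x_B]\big]$. **Theorem.** Suppose that the prior satisfies Information Substitutes and that the Bobs are $\varepsilon$-weighted aligned. Let $\lambda>0$, $\delta_{conv}\in(0,1)$ and $\zeta=\left(\frac{3|\mathcal A|}{K\,\delta_{conv}}\right)^{1/2}$. Then in every Quantal Response Nash Equilibrium $\vec C_B$, Alice's expected utility satisfies $$\mathbb E_{\mathcal I^Q(\vec C_B)}[u_A(a,y)]\ \ge\ OPT-2\varepsilon-\Big(2\big(10\zeta^{1/3}+\delta_{conv}\big)+e^{40\lambda\zeta^{1/3}}-1+\delta_{conv}\Big)-\frac{\log|\mathcal A|}{\lambda}.$$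 -/

import Mathlib

open MeasureTheory ProbabilityTheory

noncomputable section

namespace ConversationGame

/-- A private transcript between Alice and one Bob after `r` rounds: in every round a message of
Alice, followed by the reply of that Bob. -/
abbrev History (M : Type*) (r : ℕ) : Type _ := Fin r → M × M

/-- The transcripts of all `k` private conversations after `r` rounds. -/
abbrev Transcript (k : ℕ) (M : Type*) (r : ℕ) : Type _ := Fin k → History M r

/-- An instance `(x_A, x_B, y)` together with the transcripts after `r` rounds. -/
abbrev State (k : ℕ) (XA XB Y M : Type*) (r : ℕ) : Type _ := XA × XB × Y × Transcript k M r

/-- Given everybody's messages of one more round, append them to all `k` transcripts. -/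
def appendRound {k : ℕ} {M : Type*} {r : ℕ} (h : Transcript k M r) (mA mB : Fin k → M) :
    Transcript k M (r + 1) :=
  fun i => Fin.snoc (h i) (mA i, mB i)

theorem measurable_appendRound {k : ℕ} {M : Type*} [MeasurableSpace M] {r : ℕ} :
    Measurable (fun p : Transcript k M r × (Fin k → M) × (Fin k → M) =>
      appendRound p.1 p.2.1 p.2.2) := by
  refine measurable_pi_lambda _ fun i => measurable_pi_lambda _ fun j => ?_
  refine Fin.lastCases ?_ (fun j => ?_) j
  · simp only [appendRound, Fin.snoc_last]
    fun_prop
  · simp only [appendRound, Fin.snoc_castSucc]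
    fun_prop

/-- The kernel that samples the coordinates independently, the `i`-th one from `κ i`. -/
def piKernel {k : ℕ} {S M : Type*} [MeasurableSpace S] [MeasurableSpace M]
    (κ : Fin k → Kernel S M) [∀ i, IsMarkovKernel (κ i)] : Kernel S (Fin k → M) where
  toFun s := Measure.pi fun i => κ i s
  measurable' := by
    refine Measurable.measure_of_isPiSystem_of_isProbabilityMeasure
      generateFrom_pi.symm isPiSystem_pi ?_
    rintro _ ⟨t, ht, rfl⟩
    simp only [Set.mem_pi, Set.mem_univ, forall_const, Set.mem_ofPred_eq] at ht
    simp only [Measure.pi_pi]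
    exact Finset.measurable_prod _ fun i _ => (κ i).measurable_coe (ht i)

instance isMarkovKernel_piKernel {k : ℕ} {S M : Type*} [MeasurableSpace S] [MeasurableSpace M]
    (κ : Fin k → Kernel S M) [∀ i, IsMarkovKernel (κ i)] : IsMarkovKernel (piKernel κ) :=
  ⟨fun s => by
    change IsProbabilityMeasure (Measure.pi fun i => κ i s)
    infer_instance⟩

/-- A conversation rule of a Bob in a `K`-round protocol: in each round it maps his features, the
private history of the earlier rounds and Alice's current message to a distribution over
messages. -/
structure BobRule (K : ℕ) (XB M : Type*) [MeasurableSpace XB] [MeasurableSpace M] where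
  toKernel : ∀ r : Fin K, Kernel (XB × History M r × M) M
  isMarkov : ∀ r, IsMarkovKernel (toKernel r)

/-- A conversation rule of Alice: in each round it maps her features and the histories of all `k`
conversations to a (joint) distribution over messages to the Bobs. -/
structure AliceRule (k K : ℕ) (XA M : Type*) [MeasurableSpace XA] [MeasurableSpace M] where
  toKernel : ∀ r : Fin K, Kernel (XA × Transcript k M r) (Fin k → M)
  isMarkov : ∀ r, IsMarkovKernel (toKernel r)

/-- A decision rule of Alice: it maps her features and the final transcripts to a distribution over
actions. -/
structure DecisionRule (k K : ℕ) (A XA M : Type*) [MeasurableSpace A] [MeasurableSpace XA]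
    [MeasurableSpace M] where
  toKernel : Kernel (XA × Transcript k M K) A
  isMarkov : IsMarkovKernel toKernel

attribute [instance] BobRule.isMarkov AliceRule.isMarkov DecisionRule.isMarkov

/-- One round of the protocol: Alice draws her messages given `(x_A, transcripts)`, then the Bobs
reply independently, each given `(x_B, own history, Alice's message to him)`. -/
def playRound {k r : ℕ} {XA XB Y M : Type*} [MeasurableSpace XA] [MeasurableSpace XB]
    [MeasurableSpace Y] [MeasurableSpace M]
    (μ : ProbabilityMeasure (State k XA XB Y M r))
    (α : Kernel (XA × Transcript k M r) (Fin k → M)) (_hα : IsMarkovKernel α)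
    (β : Fin k → Kernel (XB × History M r × M) M) (_hβ : ∀ i, IsMarkovKernel (β i)) :
    ProbabilityMeasure (State k XA XB Y M (r + 1)) :=
  ⟨(((μ : Measure (State k XA XB Y M r)) ⊗ₘ
      α.comap (fun s : State k XA XB Y M r => (s.1, s.2.2.2)) (by fun_prop)) ⊗ₘ
      piKernel (fun i => (β i).comap
        (fun p : State k XA XB Y M r × (Fin k → M) => (p.1.2.1, p.1.2.2.2 i, p.2 i))
        (by fun_prop))).map
      (fun q : (State k XA XB Y M r × (Fin k → M)) × (Fin k → M) =>
        (q.1.1.1, q.1.1.2.1, q.1.1.2.2.1, appendRound q.1.1.2.2.2 q.1.2 q.2)),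
    Measure.isProbabilityMeasure_map (by
      have h : Measurable fun q : (State k XA XB Y M r × (Fin k → M)) × (Fin k → M) =>
          appendRound q.1.1.2.2.2 q.1.2 q.2 :=
        measurable_appendRound.comp (g := fun p : Transcript k M r × (Fin k → M) × (Fin k → M) =>
          appendRound p.1 p.2.1 p.2.2)
          (f := fun q : (State k XA XB Y M r × (Fin k → M)) × (Fin k → M) =>
            (q.1.1.2.2.2, q.1.2, q.2)) (by fun_prop)
      exact Measurable.aemeasurable (by fun_prop))⟩

/-- The softmax (logit) weights `exp (l v_a) / ∑ b, exp (l v_b)`. -/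
def softmax {A : Type*} [Fintype A] (l : ℝ) (v : A → ℝ) (a : A) : ℝ :=
  Real.exp (l * v a) / ∑ b, Real.exp (l * v b)

/-- The kernel that draws an action from the softmax weights of the vector `v s`. -/
def softmaxKernel {S A : Type*} [MeasurableSpace S] [Fintype A] [MeasurableSpace A] (l : ℝ)
    (v : S → A → ℝ) (hv : Measurable v) : Kernel S A where
  toFun s := ∑ a, ENNReal.ofReal (softmax l (v s) a) • Measure.dirac a
  measurable' := by
    refine Measure.measurable_of_measurable_coe _ fun t _ => ?_
    simp only [Measure.coe_finsetSum, Finset.sum_apply, Measure.smul_apply, smul_eq_mul, softmax]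
    refine Finset.measurable_sum _ fun a _ => Measurable.mul_const ?_ _
    fun_prop

instance isMarkovKernel_softmaxKernel {S A : Type*} [MeasurableSpace S] [Fintype A] [Nonempty A]
    [MeasurableSpace A] (l : ℝ) (v : S → A → ℝ) (hv : Measurable v) :
    IsMarkovKernel (softmaxKernel l v hv) := by
  refine ⟨fun s => ⟨?_⟩⟩
  change (∑ a, ENNReal.ofReal (softmax l (v s) a) • Measure.dirac a) Set.univ = 1
  have hpos : 0 < ∑ b, Real.exp (l * v s b) :=
    Finset.sum_pos (fun _ _ => Real.exp_pos _) Finset.univ_nonempty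
  simp only [Measure.coe_finsetSum, Finset.sum_apply, Measure.smul_apply, smul_eq_mul,
    measure_univ, mul_one]
  rw [← ENNReal.ofReal_sum_of_nonneg]
  · simp only [softmax]
    rw [← Finset.sum_div, div_self hpos.ne', ENNReal.ofReal_one]
  · intro a _
    exact div_nonneg (Real.exp_pos _).le hpos.le

end ConversationGame

open ConversationGame in
/-- The primitives of the game: the common prior of `(x_A, x_B, y)`, the utilities (with values in
`[0,1]`) of Alice and of the `k` Bobs, and a way to write vectors of `[0,1]^A` as messages, i.e.
`[0,1]^A ⊆ M` up to a measurable embedding. -/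
structure ConversationGame (k : ℕ) (A XA XB Y M : Type*) [MeasurableSpace XA] [MeasurableSpace XB]
    [MeasurableSpace Y] [MeasurableSpace M] where
  prior : ProbabilityMeasure (XA × XB × Y)
  uA : A → Y → unitInterval
  measurable_uA : ∀ a, Measurable (uA a)
  U : Fin k → A → Y → unitInterval
  measurable_U : ∀ i a, Measurable (U i a)
  enc : (A → unitInterval) → M
  measurableEmbedding_enc : MeasurableEmbedding enc

namespace ConversationGame

section

variable {k K : ℕ} {A XA XB Y M : Type*} [MeasurableSpace XA] [MeasurableSpace XB]
  [MeasurableSpace Y] [MeasurableSpace M]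

/-- Approximate weighted alignment with error `ε`. -/
def WeightedAligned (G : ConversationGame k A XA XB Y M) (ε : ℝ) : Prop :=
  ∃ (w : Fin k → ℝ) (c : ℝ), (∀ i, 0 ≤ w i) ∧ ∑ i, w i = 1 ∧
    ∀ a y, |((∑ i, w i * (G.U i a y : ℝ)) + c) - (G.uA a y : ℝ)| ≤ ε

/-- The σ-algebra generated by `x_A`. -/
abbrev sigmaA (XA XB Y : Type*) [MeasurableSpace XA] : MeasurableSpace (XA × XB × Y) :=
  MeasurableSpace.comap (fun ω => ω.1) inferInstance

/-- The σ-algebra generated by `x_B`. -/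
abbrev sigmaB (XA XB Y : Type*) [MeasurableSpace XB] : MeasurableSpace (XA × XB × Y) :=
  MeasurableSpace.comap (fun ω => ω.2.1) inferInstance

/-- The σ-algebra generated by `(x_A, x_B)`. -/
abbrev sigmaAB (XA XB Y : Type*) [MeasurableSpace XA] [MeasurableSpace XB] :
    MeasurableSpace (XA × XB × Y) :=
  MeasurableSpace.comap (fun ω => (ω.1, ω.2.1)) inferInstance

/-- The first-best utility `E [max_a E [u_A(a,y) | x_A, x_B]]`. -/
def firstBest (G : ConversationGame k A XA XB Y M) : ℝ :=
  ∫ ω, ⨆ a, ((G.prior : Measure (XA × XB × Y))[fun ω => (G.uA a ω.2.2 : ℝ) | sigmaAB XA XB Y]) ω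
    ∂(G.prior : Measure (XA × XB × Y))

/-- The information substitutes condition of the prior with respect to Alice's utility. Here
`E [u | x_A ∈ S, x_B]` is the conditional expectation given `x_B` under the prior conditioned on the
event `x_A ∈ S`, and similarly for `E [u | x_A, x_B ∈ T]`; the outer expectations are under the
prior conditioned on `x_A ∈ S, x_B ∈ T`, an event of positive probability. -/
def InformationSubstitutes (G : ConversationGame k A XA XB Y M) : Prop :=
  let P : Measure (XA × XB × Y) := G.prior
  ∀ (a : A) (S : Set XA) (T : Set XB), MeasurableSet S → MeasurableSet T →
    let evS : Set (XA × XB × Y) := {ω | ω.1 ∈ S}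
    let evT : Set (XA × XB × Y) := {ω | ω.2.1 ∈ T}
    let f : XA × XB × Y → ℝ := fun ω => (G.uA a ω.2.2 : ℝ)
    let Q : Measure (XA × XB × Y) := P[|evS ∩ evT]
    0 < P (evS ∩ evT) →
      (∫ ω, (f ω - (P[|evS][f | sigmaB XA XB Y]) ω) ^ 2 ∂Q)
          - ∫ ω, (f ω - (P[f | sigmaAB XA XB Y]) ω) ^ 2 ∂Q
        ≤ (∫ ω, (f ω - ∫ ω', f ω' ∂Q) ^ 2 ∂Q)
          - ∫ ω, (f ω - (P[|evT][f | sigmaA XA XB Y]) ω) ^ 2 ∂Q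

/-- The initial state: an instance drawn from the prior, and empty transcripts. -/
def initialLaw (G : ConversationGame k A XA XB Y M) : ProbabilityMeasure (State k XA XB Y M 0) :=
  ⟨(G.prior : Measure (XA × XB × Y)).map
      (fun ω => (ω.1, ω.2.1, ω.2.2, fun _ => Fin.elim0)),
    Measure.isProbabilityMeasure_map (Measurable.aemeasurable (by fun_prop))⟩

/-- The joint law of `(x_A, x_B, y)` and the transcripts after `r` rounds, under given conversation
rules. -/
def law (G : ConversationGame k A XA XB Y M) (CB : Fin k → BobRule K XB M)
    (CA : AliceRule k K XA M) : (r : ℕ) → r ≤ K → ProbabilityMeasure (State k XA XB Y M r)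
  | 0, _ => G.initialLaw
  | r + 1, h => playRound (G.law CB CA r (Nat.le_of_succ_le h)) (CA.toKernel ⟨r, h⟩)
      (CA.isMarkov ⟨r, h⟩) (fun i => (CB i).toKernel ⟨r, h⟩) (fun i => (CB i).isMarkov ⟨r, h⟩)

/-- The induced distribution over Alice's action and the state of the world. -/
def induced [MeasurableSpace A] (G : ConversationGame k A XA XB Y M) (CB : Fin k → BobRule K XB M)
    (CA : AliceRule k K XA M) (DA : DecisionRule k K A XA M) : Measure (A × Y) :=
  ((G.law CB CA K le_rfl : Measure (State k XA XB Y M K)) ⊗ₘ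
    DA.toKernel.comap (fun s : State k XA XB Y M K => (s.1, s.2.2.2)) (by fun_prop)).map
      (fun p => (p.2, p.1.2.2.1))

variable [StandardBorelSpace Y] [Nonempty Y]

/-- Alice's belief vector `(E [u_A(a,y) | x_A, transcripts])_a`, as a function of `x_A` and the
transcripts, when `μ` is the joint law of the instance and the transcripts: the expectation with
respect to the regular conditional distribution of `y`. -/
def belief {r : ℕ} (G : ConversationGame k A XA XB Y M)
    (μ : ProbabilityMeasure (State k XA XB Y M r)) (x : XA × Transcript k M r) (a : A) :
    unitInterval :=
  ⟨∫ y, (G.uA a y : ℝ) ∂(condDistrib (fun s : State k XA XB Y M r => s.2.2.1)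
      (fun s => (s.1, s.2.2.2)) (μ : Measure (State k XA XB Y M r)) x),
    integral_nonneg fun y => (G.uA a y).2.1, by
      refine (integral_mono_of_nonneg (Filter.Eventually.of_forall fun y => (G.uA a y).2.1)
        (integrable_const (1 : ℝ)) (Filter.Eventually.of_forall fun y => (G.uA a y).2.2)).trans ?_
      simp⟩

theorem measurable_belief {r : ℕ} (G : ConversationGame k A XA XB Y M)
    (μ : ProbabilityMeasure (State k XA XB Y M r)) : Measurable (G.belief μ) := by
  refine measurable_pi_lambda _ fun a => Measurable.subtype_mk ?_
  have h : Measurable fun y => (G.uA a y : ℝ) := (G.measurable_uA a).subtype_val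
  exact (h.stronglyMeasurable.integral_kernel
    (κ := condDistrib (fun s : State k XA XB Y M r => s.2.2.1) (fun s => (s.1, s.2.2.2))
      (μ : Measure (State k XA XB Y M r)))).measurable

/-- The straightforward message of Alice when `μ` is the joint law so far: she sends (the encoding
of) her current belief vector to every Bob. -/
def straightforwardKernel {r : ℕ} (G : ConversationGame k A XA XB Y M)
    (μ : ProbabilityMeasure (State k XA XB Y M r)) :
    Kernel (XA × Transcript k M r) (Fin k → M) :=
  Kernel.deterministic (fun x _ => G.enc (G.belief μ x))
    (measurable_pi_lambda _ fun _ =>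
      G.measurableEmbedding_enc.measurable.comp (G.measurable_belief μ))

instance isMarkovKernel_straightforwardKernel {r : ℕ} (G : ConversationGame k A XA XB Y M)
    (μ : ProbabilityMeasure (State k XA XB Y M r)) :
    IsMarkovKernel (G.straightforwardKernel μ) := by
  unfold straightforwardKernel
  infer_instance

/-- The joint law after `r` rounds when Alice converses straightforwardly and the Bobs use `CB`. -/
def straightforwardLaw (G : ConversationGame k A XA XB Y M) (CB : Fin k → BobRule K XB M) :
    (r : ℕ) → r ≤ K → ProbabilityMeasure (State k XA XB Y M r)
  | 0, _ => G.initialLaw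
  | r + 1, h => playRound (G.straightforwardLaw CB r (Nat.le_of_succ_le h))
      (G.straightforwardKernel (G.straightforwardLaw CB r (Nat.le_of_succ_le h))) inferInstance
      (fun i => (CB i).toKernel ⟨r, h⟩) (fun i => (CB i).isMarkov ⟨r, h⟩)

/-- Alice's straightforward conversation rule against the conversation rules `CB`. -/
def straightforwardRule (G : ConversationGame k A XA XB Y M) (CB : Fin k → BobRule K XB M) :
    AliceRule k K XA M where
  toKernel r := G.straightforwardKernel (G.straightforwardLaw CB r r.is_lt.le)
  isMarkov _ := inferInstance

/-- The law under the straightforward rule is the one from which its beliefs are computed. -/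
theorem law_straightforwardRule (G : ConversationGame k A XA XB Y M)
    (CB : Fin k → BobRule K XB M) (r : ℕ) (h : r ≤ K) :
    G.law CB (G.straightforwardRule CB) r h = G.straightforwardLaw CB r h := by
  induction r with
  | zero => rfl
  | succ r ih =>
    rw [law, straightforwardLaw, ih (Nat.le_of_succ_le h)]
    rfl

variable [Fintype A] [Nonempty A] [MeasurableSpace A]

/-- Alice's quantal response decision rule with parameter `l`, for the conversation rules
`CB`, `CA`: the softmax of her final belief vector. -/
def quantalRule (G : ConversationGame k A XA XB Y M) (l : ℝ) (CB : Fin k → BobRule K XB M)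
    (CA : AliceRule k K XA M) : DecisionRule k K A XA M where
  toKernel := softmaxKernel l (fun x a => (G.belief (G.law CB CA K le_rfl) x a : ℝ))
    (measurable_pi_lambda _ fun a =>
      ((measurable_pi_apply a).comp (G.measurable_belief _)).subtype_val)
  isMarkov := inferInstance

/-- The distribution of `(a, y)` induced by the Bobs' rules when Alice uses the straightforward
conversation rule and `l`-quantal response. -/
def inducedQ (G : ConversationGame k A XA XB Y M) (l : ℝ) (CB : Fin k → BobRule K XB M) :
    Measure (A × Y) :=
  G.induced CB (G.straightforwardRule CB) (G.quantalRule l CB (G.straightforwardRule CB))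

/-- Quantal Response Nash Equilibrium: no Bob gains by a unilateral change of his rule. -/
def IsQuantalResponseNash (G : ConversationGame k A XA XB Y M) (l : ℝ)
    (CB : Fin k → BobRule K XB M) : Prop :=
  ∀ (i : Fin k) (C' : BobRule K XB M),
    ∫ p, (G.U i p.1 p.2 : ℝ) ∂(G.inducedQ l (Function.update CB i C'))
      ≤ ∫ p, (G.U i p.1 p.2 : ℝ) ∂(G.inducedQ l CB)

end

end ConversationGame

end

open scoped ENNReal

/-! The bound comes from one deviation: a Bob ignores the conversation and writes an injective
encoding of `x_B` as his reply. Such an encoding exists because `X_B` is standard Borel, hence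
embeds measurably into `[0,1]`, and the message space contains `[0,1]^A`.

If any single Bob does this, Alice ends up knowing `(x_A, x_B)`. Given these features the
transcripts carry no further information on `y` (`lintegral_law_mul`), so her final belief is almost
surely the mean of her utility given both features (`belief_ae_eq_fullBelief`). She then plays the
softmax of that mean, whatever the others say. Hence the value of every utility after the deviation
is the same whichever Bob deviates (`integral_inducedQ_update_reveal`).

This removes the usual obstacle to averaging equilibrium conditions, namely that each Bob compares
with a different deviation. Weighting the `k` inequalities by `w_i` compares `∑ w_i U_i` in
equilibrium with `∑ w_i U_i` under full information. Passing from this combination to `u_A` costs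
`ε` on each side and the constant `c` cancels. The Gibbs inequality bounds the loss of softmax under
full information against the first best by `log |A| / λ`. The remaining error term of the theorem is
nonnegative. -/

/-! ### Softmax weights and the loss of softmax choice -/

theorem sum_softmax {A : Type*} [Fintype A] [Nonempty A] (l : ℝ) (v : A → ℝ) :
    ∑ a, ConversationGame.softmax l v a = 1 := by
  simp only [ConversationGame.softmax]
  rw [← Finset.sum_div, div_self]
  exact (Finset.sum_pos (fun _ _ => Real.exp_pos _) Finset.univ_nonempty).ne.symm

/-- The Gibbs inequality against the uniform distribution, in the form in which it bounds the loss of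
softmax choice. -/
theorem le_sum_softmax_mul {A : Type*} [Fintype A] [Nonempty A] {l : ℝ} (hl : 0 < l)
    (v : A → ℝ) (b : A) :
    v b - Real.log (Fintype.card A) / l ≤ ∑ a, ConversationGame.softmax l v a * v a := by
  set Z : ℝ := ∑ a, Real.exp (l * v a) with hZ
  have hZpos : 0 < Z := Finset.sum_pos (fun _ _ => Real.exp_pos _) Finset.univ_nonempty
  have hn : (0 : ℝ) < Fintype.card A := by exact_mod_cast Fintype.card_pos
  have hp : ∀ a, 0 < ConversationGame.softmax l v a := fun a => div_pos (Real.exp_pos _) hZpos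
  have hsum := sum_softmax l v
  -- The log-partition function dominates every single exponent, in particular that of `b`.
  have hb : l * v b ≤ Real.log Z := by
    rw [Real.le_log_iff_exp_le hZpos]
    exact Finset.single_le_sum (f := fun a => Real.exp (l * v a)) (fun a _ => (Real.exp_pos _).le)
      (Finset.mem_univ b)
  -- This is `log x ≤ x - 1` at `x = 1 / (|A| p_a)`, multiplied by the softmax weight `p_a`. On
  -- summing over `a` the correction terms `1/|A| - p_a` cancel.
  have hterm : ∀ a, ConversationGame.softmax l v a * (Real.log Z - Real.log (Fintype.card A))
      ≤ l * (ConversationGame.softmax l v a * v a)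
        + ((Fintype.card A : ℝ)⁻¹ - ConversationGame.softmax l v a) := by
    intro a
    have hlog : Real.log (ConversationGame.softmax l v a) = l * v a - Real.log Z := by
      rw [ConversationGame.softmax, Real.log_div (Real.exp_pos _).ne' hZpos.ne', Real.log_exp]
    have h := Real.log_le_sub_one_of_pos (inv_pos.2 (mul_pos hn (hp a)))
    rw [Real.log_inv, Real.log_mul hn.ne' (hp a).ne', hlog] at h
    have h' := mul_le_mul_of_nonneg_left h (hp a).le
    have e : ConversationGame.softmax l v a
        * ((Fintype.card A * ConversationGame.softmax l v a)⁻¹ - 1)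
        = (Fintype.card A : ℝ)⁻¹ - ConversationGame.softmax l v a := by
      have := (hp a).ne'
      field_simp
    rw [e] at h'
    linarith
  have hS := Finset.sum_le_sum fun a (_ : a ∈ Finset.univ) => hterm a
  rw [← Finset.sum_mul, hsum, Finset.sum_add_distrib, ← Finset.mul_sum, Finset.sum_sub_distrib,
    hsum, Finset.sum_const, Finset.card_univ, nsmul_eq_mul, mul_inv_cancel₀ hn.ne'] at hS
  have : l * (v b - Real.log (Fintype.card A) / l)
      ≤ l * ∑ a, ConversationGame.softmax l v a * v a := by
    rw [mul_sub, mul_div_cancel₀ _ hl.ne']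
    linarith
  exact le_of_mul_le_mul_left this hl

theorem softmax_nonneg {A : Type*} [Fintype A] (l : ℝ) (v : A → ℝ) (a : A) :
    0 ≤ ConversationGame.softmax l v a :=
  div_nonneg (Real.exp_pos _).le (Finset.sum_nonneg fun _ _ => (Real.exp_pos _).le)

theorem softmax_le_one {A : Type*} [Fintype A] (l : ℝ) (v : A → ℝ) (a : A) :
    ConversationGame.softmax l v a ≤ 1 :=
  div_le_one_of_le₀ (Finset.single_le_sum (f := fun a => Real.exp (l * v a))
    (fun _ _ => (Real.exp_pos _).le) (Finset.mem_univ a))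
    (Finset.sum_nonneg fun _ _ => (Real.exp_pos _).le)

theorem measurable_softmax {A : Type*} [Fintype A] (l : ℝ) (a : A) :
    Measurable fun v : A → ℝ => ConversationGame.softmax l v a := by
  unfold ConversationGame.softmax
  fun_prop

theorem integrable_comp_unitInterval {Ω : Type*} [MeasurableSpace Ω] (μ : Measure Ω)
    [IsFiniteMeasure μ] {f : Ω → unitInterval} (hf : Measurable f) :
    Integrable (fun ω => (f ω : ℝ)) μ :=
  Integrable.of_bound hf.subtype_val.aestronglyMeasurable 1 (Filter.Eventually.of_forall fun ω => by
    rw [Real.norm_of_nonneg (f ω).2.1]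
    exact (f ω).2.2)

theorem ConversationGame.integral_softmaxKernel {S A : Type*} [MeasurableSpace S] [Fintype A]
    [MeasurableSpace A] [MeasurableSingletonClass A] (l : ℝ) (v : S → A → ℝ)
    (hv : Measurable v) (s : S) (f : A → ℝ) :
    ∫ a, f a ∂ConversationGame.softmaxKernel l v hv s = ∑ a, ConversationGame.softmax l (v s) a * f a := by
  change ∫ a, f a ∂(∑ a, ENNReal.ofReal (ConversationGame.softmax l (v s) a) • Measure.dirac a) = _
  rw [integral_finsetSum_measure]
  · refine Finset.sum_congr rfl fun a _ => ?_
    rw [integral_smul_measure, integral_dirac, ENNReal.toReal_ofReal (softmax_nonneg l _ a),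
      smul_eq_mul]
  · intro a _
    exact (integrable_dirac (by simp)).smul_measure ENNReal.ofReal_ne_top

/-! ### Conditional means tested against nonnegative functions -/

/-- Averaging a `[0,1]`-valued function of `Z` against a function of `X` only sees the conditional
mean. -/
theorem lintegral_mul_condDistrib {Ω S Y : Type*} [MeasurableSpace Ω] [MeasurableSpace S]
    [MeasurableSpace Y] [StandardBorelSpace Y] [Nonempty Y] (μ : Measure Ω) [IsProbabilityMeasure μ]
    {X : Ω → S} (hX : Measurable X) {Z : Ω → Y} (hZ : Measurable Z) {u : Y → unitInterval}
    (hu : Measurable u) {g : S → ℝ≥0∞} (hg : Measurable g) :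
    ∫⁻ ω, ENNReal.ofReal (u (Z ω)) * g (X ω) ∂μ
      = ∫⁻ ω, ENNReal.ofReal (∫ y, (u y : ℝ) ∂condDistrib Z X μ (X ω)) * g (X ω) ∂μ := by
  have huR : Measurable fun y => (u y : ℝ) := hu.subtype_val
  have hF : Measurable fun p : S × Y => ENNReal.ofReal (u p.2) * g p.1 := by fun_prop
  have h1 : ∫⁻ ω, ENNReal.ofReal (u (Z ω)) * g (X ω) ∂μ
      = ∫⁻ p, ENNReal.ofReal (u p.2) * g p.1 ∂(μ.map fun ω => (X ω, Z ω)) := by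
    rw [lintegral_map hF (by fun_prop)]
  have hK : Measurable fun x => ∫ y, (u y : ℝ) ∂condDistrib Z X μ x :=
    (huR.stronglyMeasurable.integral_kernel (κ := condDistrib Z X μ)).measurable
  rw [h1, ← compProd_map_condDistrib hZ.aemeasurable, Measure.lintegral_compProd hF,
    ← lintegral_map (f := fun x => ENNReal.ofReal (∫ y, (u y : ℝ) ∂condDistrib Z X μ x) * g x)
      (by fun_prop) hX]
  refine lintegral_congr fun x => ?_
  dsimp only
  rw [lintegral_mul_const _ (by fun_prop), ofReal_integral_eq_lintegral_ofReal]
  · refine Integrable.of_bound huR.aestronglyMeasurable 1 (Filter.Eventually.of_forall fun y => ?_)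
    rw [Real.norm_of_nonneg (u y).2.1]
    exact (u y).2.2
  · exact Filter.Eventually.of_forall fun y => (u y).2.1

/-- Uniqueness of conditional means: indicator test functions already determine a density with
respect to the law of `X`, which is finite. It serves to identify Alice's belief with a candidate
that is also a function of what she knows. -/
theorem comp_ae_eq_of_lintegral_mul_eq {Ω S : Type*} [MeasurableSpace Ω] [MeasurableSpace S]
    (μ : Measure Ω) [IsProbabilityMeasure μ] {X : Ω → S} (hX : Measurable X) {b m : S → ℝ≥0∞}
    (hb : Measurable b) (hm : Measurable m)
    (h : ∀ g : S → ℝ≥0∞, Measurable g →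
      ∫⁻ ω, b (X ω) * g (X ω) ∂μ = ∫⁻ ω, m (X ω) * g (X ω) ∂μ) :
    ∀ᵐ ω ∂μ, b (X ω) = m (X ω) := by
  have : IsProbabilityMeasure (μ.map X) := Measure.isProbabilityMeasure_map hX.aemeasurable
  refine ae_of_ae_map hX.aemeasurable (p := fun s => b s = m s) ?_
  refine ae_eq_of_forall_setLIntegral_eq_of_sigmaFinite hb hm fun s hs _ => ?_
  have hg : Measurable (s.indicator (1 : S → ℝ≥0∞)) := measurable_one.indicator hs
  have e : ∀ c : S → ℝ≥0∞, Measurable c →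
      ∫⁻ x in s, c x ∂(μ.map X) = ∫⁻ ω, c (X ω) * s.indicator 1 (X ω) ∂μ := by
    intro c hc
    rw [← lintegral_map (f := fun x => c x * s.indicator 1 x) (hc.mul hg) hX,
      ← lintegral_indicator hs]
    refine lintegral_congr fun x => ?_
    by_cases hx : x ∈ s <;> simp [hx]
  rw [e b hb, e m hm, h _ hg]

/-- The messages can carry the features of a Bob without loss. -/
theorem ConversationGame.exists_measurable_leftInverse {k : ℕ} {A XA XB Y M : Type*} [Fintype A]
    [Nonempty A] [MeasurableSpace XA] [MeasurableSpace XB] [StandardBorelSpace XB] [Nonempty XB]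
    [MeasurableSpace Y] [MeasurableSpace M] (G : ConversationGame k A XA XB Y M) :
    ∃ (e : XB → M) (d : M → XB), Measurable e ∧ Measurable d ∧ ∀ x, d (e x) = x := by
  -- The features are squeezed into `[0,1]` by the sigmoid and repeated in every coordinate; one
  -- coordinate, available since `A` is nonempty, recovers them.
  have h1 : MeasurableEmbedding fun x : XB => fun _ : A =>
      unitInterval.sigmoid (embeddingReal XB x) :=
    Measurable.measurableEmbedding
      (measurable_pi_lambda _ fun _ => (measurableEmbedding_sigmoid_comp_embeddingReal XB).measurable)
      (fun x x' h => (measurableEmbedding_sigmoid_comp_embeddingReal XB).injective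
        (congrFun h (Classical.arbitrary A)))
  have h2 := G.measurableEmbedding_enc.comp h1
  exact ⟨_, h2.invFun, h2.measurable, h2.measurable_invFun, h2.leftInverse_invFun⟩

/-! ### One round as a Markov kernel on transcripts -/

namespace ConversationGame

/-- The transition of the transcripts in one round, given the features of both sides. -/
noncomputable def roundKernel {k r : ℕ} {XA XB M : Type*} [MeasurableSpace XA] [MeasurableSpace XB]
    [MeasurableSpace M] (α : Kernel (XA × Transcript k M r) (Fin k → M))
    (β : Fin k → Kernel (XB × History M r × M) M) [∀ i, IsMarkovKernel (β i)] :
    Kernel (XA × XB × Transcript k M r) (Transcript k M (r + 1)) :=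
  (Kernel.id ×ₖ ((α.comap (fun s : XA × XB × Transcript k M r => (s.1, s.2.2)) (by fun_prop)) ⊗ₖ
      piKernel (fun i => (β i).comap
        (fun p : (XA × XB × Transcript k M r) × (Fin k → M) => (p.1.2.1, p.1.2.2 i, p.2 i))
        (by fun_prop)))).map
    (fun q => appendRound q.1.2.2 q.2.1 q.2.2)

theorem lintegral_roundKernel {k r : ℕ} {XA XB M : Type*} [MeasurableSpace XA] [MeasurableSpace XB]
    [MeasurableSpace M] (α : Kernel (XA × Transcript k M r) (Fin k → M)) [IsMarkovKernel α]
    (β : Fin k → Kernel (XB × History M r × M) M) [∀ i, IsMarkovKernel (β i)]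
    (x : XA × XB × Transcript k M r) {f : Transcript k M (r + 1) → ℝ≥0∞} (hf : Measurable f) :
    ∫⁻ t, f t ∂roundKernel α β x
      = ∫⁻ mA, ∫⁻ mB, f (appendRound x.2.2 mA mB)
          ∂Measure.pi (fun i => β i (x.2.1, x.2.2 i, mA i)) ∂α (x.1, x.2.2) := by
  have happ : Measurable fun q : (XA × XB × Transcript k M r) × (Fin k → M) × (Fin k → M) =>
      appendRound q.1.2.2 q.2.1 q.2.2 :=
    measurable_appendRound.comp (g := fun p : Transcript k M r × (Fin k → M) × (Fin k → M) =>
      appendRound p.1 p.2.1 p.2.2)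
      (f := fun q : (XA × XB × Transcript k M r) × (Fin k → M) × (Fin k → M) =>
        (q.1.2.2, q.2.1, q.2.2)) (by fun_prop)
  have hF : Measurable fun q : (XA × XB × Transcript k M r) × (Fin k → M) × (Fin k → M) =>
      f (appendRound q.1.2.2 q.2.1 q.2.2) := hf.comp happ
  rw [roundKernel, Kernel.lintegral_map _ happ _ hf, Kernel.lintegral_prod _ _ _ hF,
    Kernel.lintegral_id']
  · have hc : Measurable fun c : (Fin k → M) × (Fin k → M) => f (appendRound x.2.2 c.1 c.2) :=
      hF.comp measurable_prodMk_left
    exact Kernel.lintegral_compProd _ _ _ hc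
  · exact hF.lintegral_prod_right'

instance isMarkovKernel_roundKernel {k r : ℕ} {XA XB M : Type*} [MeasurableSpace XA]
    [MeasurableSpace XB] [MeasurableSpace M] (α : Kernel (XA × Transcript k M r) (Fin k → M))
    [IsMarkovKernel α] (β : Fin k → Kernel (XB × History M r × M) M) [∀ i, IsMarkovKernel (β i)] :
    IsMarkovKernel (roundKernel (XA := XA) α β) := by
  refine ⟨fun x => ⟨?_⟩⟩
  rw [← lintegral_one, lintegral_roundKernel α β x measurable_const]
  simp

/-- The new transcripts are drawn by a kernel that does not see `y`. In this form, facts about the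
conditional law of `y` pass from one round to the next by integrating out the new messages. -/
theorem lintegral_playRound {k r : ℕ} {XA XB Y M : Type*} [MeasurableSpace XA] [MeasurableSpace XB]
    [MeasurableSpace Y] [MeasurableSpace M] (μ : ProbabilityMeasure (State k XA XB Y M r))
    (α : Kernel (XA × Transcript k M r) (Fin k → M)) (hα : IsMarkovKernel α)
    (β : Fin k → Kernel (XB × History M r × M) M) (hβ : ∀ i, IsMarkovKernel (β i))
    {f : State k XA XB Y M (r + 1) → ℝ≥0∞} (hf : Measurable f) :
    ∫⁻ s, f s ∂(playRound μ α hα β hβ : Measure (State k XA XB Y M (r + 1)))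
      = ∫⁻ s, ∫⁻ t, f (s.1, s.2.1, s.2.2.1, t) ∂roundKernel α β (s.1, s.2.1, s.2.2.2)
          ∂(μ : Measure (State k XA XB Y M r)) := by
  have happ : Measurable fun q : (State k XA XB Y M r × (Fin k → M)) × (Fin k → M) =>
      appendRound q.1.1.2.2.2 q.1.2 q.2 :=
    measurable_appendRound.comp (g := fun p : Transcript k M r × (Fin k → M) × (Fin k → M) =>
      appendRound p.1 p.2.1 p.2.2)
      (f := fun q : (State k XA XB Y M r × (Fin k → M)) × (Fin k → M) =>
        (q.1.1.2.2.2, q.1.2, q.2)) (by fun_prop)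
  have hmap : Measurable fun q : (State k XA XB Y M r × (Fin k → M)) × (Fin k → M) =>
      ((q.1.1.1, q.1.1.2.1, q.1.1.2.2.1, appendRound q.1.1.2.2.2 q.1.2 q.2) :
        State k XA XB Y M (r + 1)) := by fun_prop
  have hF : Measurable fun q : (State k XA XB Y M r × (Fin k → M)) × (Fin k → M) =>
      f (q.1.1.1, q.1.1.2.1, q.1.1.2.2.1, appendRound q.1.1.2.2.2 q.1.2 q.2) := hf.comp hmap
  change ∫⁻ s, f s ∂(Measure.map _ _) = _
  rw [lintegral_map hf hmap, Measure.lintegral_compProd hF,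
    Measure.lintegral_compProd hF.lintegral_kernel_prod_right']
  refine lintegral_congr fun s => ?_
  have ht : Measurable fun t => f (s.1, s.2.1, s.2.2.1, t) := by fun_prop
  rw [lintegral_roundKernel α β _ ht]
  rfl

/-! ### The law of the instance and the transcripts -/

section

variable {k K : ℕ} {A XA XB Y M : Type*} [MeasurableSpace XA] [MeasurableSpace XB]
  [MeasurableSpace Y] [MeasurableSpace M]

/-- The conversation does not affect the law of the instance. -/
theorem lintegral_law_instance (G : ConversationGame k A XA XB Y M) (CB : Fin k → BobRule K XB M)
    (CA : AliceRule k K XA M) {g : XA × XB × Y → ℝ≥0∞} (hg : Measurable g) (r : ℕ) (hr : r ≤ K) :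
    ∫⁻ s, g (s.1, s.2.1, s.2.2.1) ∂(G.law CB CA r hr : Measure (State k XA XB Y M r))
      = ∫⁻ ω, g ω ∂(G.prior : Measure (XA × XB × Y)) := by
  induction r with
  | zero =>
    change ∫⁻ s, _ ∂(Measure.map _ _) = _
    rw [lintegral_map (by fun_prop) (by fun_prop)]
  | succ r ih =>
    have hβ : ∀ i, IsMarkovKernel ((CB i).toKernel ⟨r, hr⟩) := fun i => (CB i).isMarkov ⟨r, hr⟩
    rw [law, lintegral_playRound _ _ _ _ _ (by fun_prop), ← ih (Nat.le_of_succ_le hr)]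
    simp

theorem map_law_instance (G : ConversationGame k A XA XB Y M) (CB : Fin k → BobRule K XB M)
    (CA : AliceRule k K XA M) (r : ℕ) (hr : r ≤ K) :
    (G.law CB CA r hr : Measure (State k XA XB Y M r)).map (fun s => (s.1, s.2.1, s.2.2.1))
      = G.prior := by
  refine Measure.ext_of_lintegral _ fun g hg => ?_
  rw [lintegral_map hg (by fun_prop), lintegral_law_instance G CB CA hg r hr]

/-- Given the features, the transcripts carry no information about the state of the world. -/
theorem lintegral_law_mul (G : ConversationGame k A XA XB Y M) (CB : Fin k → BobRule K XB M)
    (CA : AliceRule k K XA M) {u : Y → ℝ≥0∞} (hu : Measurable u) {m : XA × XB → ℝ≥0∞}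
    (hm : Measurable m)
    (h : ∀ g : XA × XB → ℝ≥0∞, Measurable g →
      ∫⁻ ω, u ω.2.2 * g (ω.1, ω.2.1) ∂(G.prior : Measure (XA × XB × Y))
        = ∫⁻ ω, m (ω.1, ω.2.1) * g (ω.1, ω.2.1) ∂(G.prior : Measure (XA × XB × Y)))
    (r : ℕ) (hr : r ≤ K) {g : XA × XB × Transcript k M r → ℝ≥0∞} (hg : Measurable g) :
    ∫⁻ s, u s.2.2.1 * g (s.1, s.2.1, s.2.2.2) ∂(G.law CB CA r hr : Measure (State k XA XB Y M r))
      = ∫⁻ s, m (s.1, s.2.1) * g (s.1, s.2.1, s.2.2.2)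
          ∂(G.law CB CA r hr : Measure (State k XA XB Y M r)) := by
  induction r with
  | zero =>
    change ∫⁻ s, _ ∂(Measure.map _ _) = ∫⁻ s, _ ∂(Measure.map _ _)
    rw [lintegral_map (by fun_prop) (by fun_prop), lintegral_map (by fun_prop) (by fun_prop)]
    exact h (fun x => g (x.1, x.2, fun _ => Fin.elim0)) (hg.comp (by fun_prop))
  | succ r ih =>
    have hα : IsMarkovKernel (CA.toKernel ⟨r, hr⟩) := CA.isMarkov ⟨r, hr⟩
    have hβ : ∀ i, IsMarkovKernel ((CB i).toKernel ⟨r, hr⟩) := fun i => (CB i).isMarkov ⟨r, hr⟩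
    rw [law, lintegral_playRound _ _ _ _ _ (by fun_prop),
      lintegral_playRound _ _ _ _ _ (by fun_prop)]
    -- Averaging the test function over the new round gives a test function of the features and the
    -- earlier transcripts, to which the induction hypothesis applies.
    have hg' : Measurable fun x : XA × XB × Transcript k M r =>
        ∫⁻ t, g (x.1, x.2.1, t) ∂roundKernel (CA.toKernel ⟨r, hr⟩)
          (fun i => (CB i).toKernel ⟨r, hr⟩) x :=
      Measurable.lintegral_kernel_prod_right (f := fun (x : XA × XB × Transcript k M r) t =>
        g (x.1, x.2.1, t)) (by unfold Function.uncurry; fun_prop)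
    have key := ih (Nat.le_of_succ_le hr) hg'
    have ht : ∀ s : State k XA XB Y M r, Measurable fun t => g (s.1, s.2.1, t) := fun s => by
      fun_prop
    refine Eq.trans (lintegral_congr fun s => ?_) (key.trans (lintegral_congr fun s => ?_))
    · exact lintegral_const_mul (u s.2.2.1) (ht s)
    · exact (lintegral_const_mul (m (s.1, s.2.1)) (ht s)).symm

/-- The rule of a Bob who writes an encoding of his features in every round. -/
noncomputable def BobRule.reveal (K : ℕ) {e : XB → M} (he : Measurable e) : BobRule K XB M where
  toKernel _ := Kernel.deterministic (fun x => e x.1) (by fun_prop)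
  isMarkov _ := inferInstance

/-- Decoding the last reply suffices, so only the final round has to be unfolded and everything
before it is arbitrary. Alice's rule is arbitrary too, which matters because her straightforward
rule changes with the deviation. -/
theorem ae_law_reveal [StandardBorelSpace XB] (G : ConversationGame k A XA XB Y M)
    {r : ℕ} (CB : Fin k → BobRule (r + 1) XB M) (CA : AliceRule k (r + 1) XA M)
    {e : XB → M} (he : Measurable e) {d : M → XB} (hd : Measurable d) (hde : ∀ x, d (e x) = x)
    (i : Fin k) (hi : CB i = BobRule.reveal (r + 1) he) :
    ∀ᵐ s ∂(G.law CB CA (r + 1) le_rfl : Measure (State k XA XB Y M (r + 1))),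
      d (s.2.2.2 i (Fin.last r)).2 = s.2.1 := by
  have hα : IsMarkovKernel (CA.toKernel ⟨r, r.lt_succ_self⟩) := CA.isMarkov _
  have hβ : ∀ j, IsMarkovKernel ((CB j).toKernel ⟨r, r.lt_succ_self⟩) := fun j => (CB j).isMarkov _
  have hS : MeasurableSet {s : State k XA XB Y M (r + 1) | d (s.2.2.2 i (Fin.last r)).2 = s.2.1} :=
    measurableSet_eq_fun (by fun_prop) (by fun_prop)
  have hSc : Measurable ({s : State k XA XB Y M (r + 1) |
      d (s.2.2.2 i (Fin.last r)).2 = s.2.1}ᶜ.indicator (1 : State k XA XB Y M (r + 1) → ℝ≥0∞)) :=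
    measurable_one.indicator hS.compl
  rw [ae_iff]
  change (G.law CB CA (r + 1) le_rfl : Measure (State k XA XB Y M (r + 1)))
    {s | d (s.2.2.2 i (Fin.last r)).2 = s.2.1}ᶜ = 0
  rw [← lintegral_indicator_one hS.compl, law, lintegral_playRound _ _ _ _ _ hSc]
  refine (lintegral_congr fun s => ?_).trans lintegral_zero
  have ht : Measurable fun t => {s : State k XA XB Y M (r + 1) |
      d (s.2.2.2 i (Fin.last r)).2 = s.2.1}ᶜ.indicator (1 : State k XA XB Y M (r + 1) → ℝ≥0∞)
      (s.1, s.2.1, s.2.2.1, t) := by fun_prop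
  rw [lintegral_roundKernel _ _ _ ht]
  refine (lintegral_congr fun mA => ?_).trans lintegral_zero
  refine (lintegral_congr_ae ?_).trans lintegral_zero
  -- The replies are independent, so the reply of Bob `i` has his own kernel as marginal, here a
  -- point mass at `e x_B`.
  have hmp := measurePreserving_eval
    (fun j => (CB j).toKernel ⟨r, r.lt_succ_self⟩ (s.2.1, s.2.2.2 j, mA j)) i
  have hae : ∀ᵐ m ∂((CB i).toKernel ⟨r, r.lt_succ_self⟩ (s.2.1, s.2.2.2 i, mA i)), d m = s.2.1 := by
    rw [hi]
    change ∀ᵐ m ∂(Measure.dirac (e s.2.1)), d m = s.2.1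
    rw [ae_dirac_iff (measurableSet_eq_fun hd measurable_const)]
    exact hde _
  filter_upwards [hmp.quasiMeasurePreserving.ae hae] with mB hmB
  simpa [appendRound] using hmB

end

end ConversationGame

/-! ### Beliefs under full information -/

namespace ConversationGame

section

variable {k K : ℕ} {A XA XB Y M : Type*} [MeasurableSpace XA] [MeasurableSpace XB]
  [MeasurableSpace Y] [MeasurableSpace M] [StandardBorelSpace Y] [Nonempty Y]

/-- The mean of Alice's utility given the features of both sides. -/
noncomputable def fullBelief (G : ConversationGame k A XA XB Y M) (x : XA × XB) (a : A) : ℝ :=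
  ∫ y, (G.uA a y : ℝ) ∂(condDistrib (fun ω : XA × XB × Y => ω.2.2) (fun ω => (ω.1, ω.2.1))
    (G.prior : Measure (XA × XB × Y)) x)

theorem fullBelief_nonneg (G : ConversationGame k A XA XB Y M) (x : XA × XB) (a : A) :
    0 ≤ G.fullBelief x a :=
  integral_nonneg fun y => (G.uA a y).2.1

theorem measurable_fullBelief (G : ConversationGame k A XA XB Y M) : Measurable G.fullBelief := by
  refine measurable_pi_lambda _ fun a => ?_
  have h : Measurable fun y => (G.uA a y : ℝ) := (G.measurable_uA a).subtype_val
  exact (h.stronglyMeasurable.integral_kernel (κ := condDistrib (fun ω : XA × XB × Y => ω.2.2)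
    (fun ω => (ω.1, ω.2.1)) (G.prior : Measure (XA × XB × Y)))).measurable

theorem condExp_ae_eq_fullBelief (G : ConversationGame k A XA XB Y M) (a : A) :
    (G.prior : Measure (XA × XB × Y))[fun ω => (G.uA a ω.2.2 : ℝ) | sigmaAB XA XB Y]
      =ᵐ[(G.prior : Measure (XA × XB × Y))] fun ω => G.fullBelief (ω.1, ω.2.1) a :=
  condExp_ae_eq_integral_condDistrib (Y := fun ω : XA × XB × Y => ω.2.2)
    (X := fun ω : XA × XB × Y => (ω.1, ω.2.1)) (by fun_prop) (by fun_prop)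
    (f := fun y => (G.uA a y : ℝ)) (G.measurable_uA a).subtype_val.stronglyMeasurable
    (integrable_comp_unitInterval _ ((G.measurable_uA a).comp (by fun_prop)))

/-- If the transcripts reveal the features of the Bobs, then Alice's belief is the mean of her
utility given the features of both sides. -/
theorem belief_ae_eq_fullBelief [Countable A] (G : ConversationGame k A XA XB Y M)
    (CB : Fin k → BobRule K XB M) (CA : AliceRule k K XA M) (r : ℕ) (hr : r ≤ K)
    {D : Transcript k M r → XB} (hD : Measurable D)
    (hrev : ∀ᵐ s ∂(G.law CB CA r hr : Measure (State k XA XB Y M r)), D s.2.2.2 = s.2.1) :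
    ∀ᵐ s ∂(G.law CB CA r hr : Measure (State k XA XB Y M r)), ∀ a,
      (G.belief (G.law CB CA r hr) (s.1, s.2.2.2) a : ℝ) = G.fullBelief (s.1, s.2.1) a := by
  refine ae_all_iff.2 fun a => ?_
  have hu := G.measurable_uA a
  have huR : Measurable fun y => ENNReal.ofReal (G.uA a y : ℝ) := by fun_prop
  have hm : Measurable fun x : XA × XB => ENNReal.ofReal (G.fullBelief x a) :=
    ((measurable_pi_apply a).comp G.measurable_fullBelief).ennreal_ofReal
  have hb : Measurable fun x => ENNReal.ofReal (G.belief (G.law CB CA r hr) x a : ℝ) :=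
    (((measurable_pi_apply a).comp (G.measurable_belief _)).subtype_val).ennreal_ofReal
  have hprior : ∀ g : XA × XB → ℝ≥0∞, Measurable g →
      ∫⁻ ω, ENNReal.ofReal (G.uA a ω.2.2 : ℝ) * g (ω.1, ω.2.1) ∂(G.prior : Measure (XA × XB × Y))
        = ∫⁻ ω, ENNReal.ofReal (G.fullBelief (ω.1, ω.2.1) a) * g (ω.1, ω.2.1)
            ∂(G.prior : Measure (XA × XB × Y)) := fun g hg =>
    lintegral_mul_condDistrib (G.prior : Measure (XA × XB × Y)) (X := fun ω => (ω.1, ω.2.1))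
      (by fun_prop) (Z := fun ω => ω.2.2) (by fun_prop) hu hg
  -- The candidate reads `x_B` off the transcripts through `D`, which makes it a function of `(x_A,
  -- transcripts)` as `comp_ae_eq_of_lintegral_mul_eq` requires. Both sides have the same integrals
  -- against test functions of these data: for the belief by definition of the conditional
  -- distribution, for the candidate by `lintegral_law_mul` and `hrev`.
  have key := comp_ae_eq_of_lintegral_mul_eq
    (G.law CB CA r hr : Measure (State k XA XB Y M r)) (X := fun s => (s.1, s.2.2.2))
    (by fun_prop) hb (m := fun x => ENNReal.ofReal (G.fullBelief (x.1, D x.2) a))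
    (hm.comp (by fun_prop)) (fun g hg => by
      refine (lintegral_mul_condDistrib (G.law CB CA r hr : Measure (State k XA XB Y M r))
        (X := fun s => (s.1, s.2.2.2)) (by fun_prop) (Z := fun s => s.2.2.1) (by fun_prop)
        hu hg).symm.trans ?_
      refine (lintegral_law_mul G CB CA huR hm hprior r hr
        (g := fun x => g (x.1, x.2.2)) (by fun_prop)).trans (lintegral_congr_ae ?_)
      filter_upwards [hrev] with s hs
      rw [hs])
  filter_upwards [key, hrev] with s hs hs'
  rw [hs'] at hs
  exact (ENNReal.ofReal_eq_ofReal_iff (G.belief (G.law CB CA r hr) (s.1, s.2.2.2) a).2.1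
    (G.fullBelief_nonneg _ a)).1 hs

end

/-! ### Weighted alignment in expectation -/

section

variable {k : ℕ} {A XA XB Y M : Type*} [MeasurableSpace XA] [MeasurableSpace XB]
  [MeasurableSpace Y] [MeasurableSpace M] [Fintype A] [MeasurableSpace A]
  [MeasurableSingletonClass A]

/-- Pointwise alignment passes to expectations. -/
theorem abs_sum_integral_sub_le (G : ConversationGame k A XA XB Y M) {w : Fin k → ℝ} {c ε : ℝ}
    (h : ∀ a y, |((∑ i, w i * (G.U i a y : ℝ)) + c) - (G.uA a y : ℝ)| ≤ ε)
    (q : Measure (A × Y)) [IsProbabilityMeasure q] :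
    |((∑ i, w i * ∫ p, (G.U i p.1 p.2 : ℝ) ∂q) + c) - ∫ p, (G.uA p.1 p.2 : ℝ) ∂q| ≤ ε := by
  have hA : Integrable (fun p : A × Y => (G.uA p.1 p.2 : ℝ)) q :=
    integrable_comp_unitInterval q (measurable_from_prod_countable_right G.measurable_uA)
  have hU : ∀ i, Integrable (fun p : A × Y => w i * (G.U i p.1 p.2 : ℝ)) q := fun i =>
    (integrable_comp_unitInterval q (measurable_from_prod_countable_right (G.measurable_U i))).const_mul _
  have hS := integrable_finsetSum Finset.univ fun i _ => hU i
  have hSc : Integrable (fun p : A × Y => (∑ i, w i * (G.U i p.1 p.2 : ℝ)) + c) q :=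
    hS.add (integrable_const c)
  have e : ∫ p, (((∑ i, w i * (G.U i p.1 p.2 : ℝ)) + c) - (G.uA p.1 p.2 : ℝ)) ∂q
      = ((∑ i, w i * ∫ p, (G.U i p.1 p.2 : ℝ) ∂q) + c) - ∫ p, (G.uA p.1 p.2 : ℝ) ∂q := by
    rw [integral_sub hSc hA, integral_add hS (integrable_const c),
      integral_finsetSum _ fun i _ => hU i]
    simp [integral_const_mul]
  rw [← e, ← Real.norm_eq_abs]
  refine (norm_integral_le_of_norm_le_const (C := ε)
    (Filter.Eventually.of_forall fun p => h p.1 p.2)).trans ?_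
  simp

end

/-! ### The value of quantal response to full information -/

section

variable {k : ℕ} {A XA XB Y M : Type*} [MeasurableSpace XA] [MeasurableSpace XB]
  [MeasurableSpace Y] [MeasurableSpace M] [StandardBorelSpace Y] [Nonempty Y]
  [Fintype A]

/-- The value of `v` when the action is the quantal response to the features of both sides. -/
noncomputable def fullInformationValue (G : ConversationGame k A XA XB Y M) (l : ℝ)
    (v : A → Y → unitInterval) : ℝ :=
  ∫ ω, ∑ a, softmax l (G.fullBelief (ω.1, ω.2.1)) a * (v a ω.2.2 : ℝ)
    ∂(G.prior : Measure (XA × XB × Y))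

/-- Quantal response to full information loses at most `log |A| / l` against the first best. -/
theorem firstBest_sub_le_fullInformationValue [Nonempty A]
    (G : ConversationGame k A XA XB Y M) {l : ℝ} (hl : 0 < l) :
    G.firstBest - Real.log (Fintype.card A) / l ≤ G.fullInformationValue l G.uA := by
  have hsm : ∀ a, Measurable fun x : XA × XB => softmax l (G.fullBelief x) a := fun a =>
    (measurable_softmax l a).comp G.measurable_fullBelief
  have hfb : ∀ a, Measurable fun x : XA × XB => G.fullBelief x a := fun a =>
    (measurable_pi_apply a).comp G.measurable_fullBelief
  have hle1 : ∀ x a, G.fullBelief x a ≤ 1 := by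
    intro x a
    refine (integral_mono_of_nonneg (Filter.Eventually.of_forall fun y => (G.uA a y).2.1)
      (integrable_const (1 : ℝ)) (Filter.Eventually.of_forall fun y => (G.uA a y).2.2)).trans ?_
    simp
  have hbound : ∀ a (x : ℝ) (p : XA × XB), 0 ≤ x → x ≤ 1 →
      ‖softmax l (G.fullBelief p) a * x‖ ≤ 1 := by
    intro a x p h0 h1
    rw [Real.norm_of_nonneg (mul_nonneg (softmax_nonneg l _ a) h0)]
    exact mul_le_one₀ (softmax_le_one l _ a) h0 h1
  have hint1 : ∀ a, Integrable (fun ω : XA × XB × Y =>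
      softmax l (G.fullBelief (ω.1, ω.2.1)) a * (G.uA a ω.2.2 : ℝ))
      (G.prior : Measure (XA × XB × Y)) := fun a =>
    Integrable.of_bound (((hsm a).comp (by fun_prop)).mul ((G.measurable_uA a).comp
      (by fun_prop)).subtype_val).aestronglyMeasurable 1
      (Filter.Eventually.of_forall fun ω => hbound a _ _ (G.uA a ω.2.2).2.1 (G.uA a ω.2.2).2.2)
  have hint2 : ∀ a, Integrable (fun ω : XA × XB × Y =>
      softmax l (G.fullBelief (ω.1, ω.2.1)) a * G.fullBelief (ω.1, ω.2.1) a)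
      (G.prior : Measure (XA × XB × Y)) := fun a =>
    Integrable.of_bound (((hsm a).comp (by fun_prop)).mul ((hfb a).comp
      (by fun_prop))).aestronglyMeasurable 1
      (Filter.Eventually.of_forall fun ω => hbound a _ _ (G.fullBelief_nonneg _ a) (hle1 _ a))
  -- The weights depend on the features only, so `u_A` may be replaced by its conditional mean; the
  -- loss of softmax can then be bounded pointwise.
  have hmean : ∀ a, ∫ ω, softmax l (G.fullBelief (ω.1, ω.2.1)) a * (G.uA a ω.2.2 : ℝ)
        ∂(G.prior : Measure (XA × XB × Y))
      = ∫ ω, softmax l (G.fullBelief (ω.1, ω.2.1)) a * G.fullBelief (ω.1, ω.2.1) a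
        ∂(G.prior : Measure (XA × XB × Y)) := by
    intro a
    rw [integral_eq_lintegral_of_nonneg_ae
        (Filter.Eventually.of_forall fun ω => mul_nonneg (softmax_nonneg l _ a) (G.uA a _).2.1)
        (hint1 a).aestronglyMeasurable,
      integral_eq_lintegral_of_nonneg_ae
        (Filter.Eventually.of_forall fun ω =>
          mul_nonneg (softmax_nonneg l _ a) (G.fullBelief_nonneg _ a))
        (hint2 a).aestronglyMeasurable]
    simp_rw [ENNReal.ofReal_mul (softmax_nonneg l _ a), mul_comm (ENNReal.ofReal (softmax _ _ _))]
    exact congrArg ENNReal.toReal (lintegral_mul_condDistrib (G.prior : Measure (XA × XB × Y))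
      (X := fun ω => (ω.1, ω.2.1)) (by fun_prop) (Z := fun ω => ω.2.2) (by fun_prop)
      (G.measurable_uA a) (g := fun x => ENNReal.ofReal (softmax l (G.fullBelief x) a))
      (hsm a).ennreal_ofReal)
  have hfirst : G.firstBest
      = ∫ ω, ⨆ a, G.fullBelief (ω.1, ω.2.1) a ∂(G.prior : Measure (XA × XB × Y)) := by
    refine integral_congr_ae ?_
    filter_upwards [ae_all_iff.2 fun a => G.condExp_ae_eq_fullBelief a] with ω hω
    simp only [hω]
  have hsup : Integrable (fun ω : XA × XB × Y => ⨆ a, G.fullBelief (ω.1, ω.2.1) a)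
      (G.prior : Measure (XA × XB × Y)) := by
    refine Integrable.of_bound (Measurable.aestronglyMeasurable
      (Measurable.iSup fun a => (hfb a).comp (by fun_prop))) 1
      (Filter.Eventually.of_forall fun ω => ?_)
    rw [Real.norm_of_nonneg (Real.iSup_nonneg fun a => G.fullBelief_nonneg _ a)]
    exact ciSup_le fun a => hle1 _ a
  rw [fullInformationValue, integral_finsetSum _ fun a _ => hint1 a,
    Finset.sum_congr rfl fun a _ => hmean a, ← integral_finsetSum _ fun a _ => hint2 a, hfirst]
  have hsub : ∫ ω, ((⨆ a, G.fullBelief (ω.1, ω.2.1) a) - Real.log (Fintype.card A) / l)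
        ∂(G.prior : Measure (XA × XB × Y))
      = (∫ ω, ⨆ a, G.fullBelief (ω.1, ω.2.1) a ∂(G.prior : Measure (XA × XB × Y)))
        - Real.log (Fintype.card A) / l := by
    rw [integral_sub hsup (integrable_const _)]
    simp
  rw [← hsub]
  refine integral_mono (hsup.sub (integrable_const _)) (integrable_finsetSum _ fun a _ => hint2 a)
    fun ω => ?_
  obtain ⟨b, hb⟩ := exists_eq_ciSup_of_finite (f := fun a => G.fullBelief (ω.1, ω.2.1) a)
  simp only [← hb]
  exact le_sum_softmax_mul hl _ b

end

/-! ### Revealing deviations and the equilibrium bound -/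

section

variable {k K : ℕ} {A XA XB Y M : Type*} [MeasurableSpace XA] [MeasurableSpace XB]
  [MeasurableSpace Y] [MeasurableSpace M] [StandardBorelSpace Y] [Nonempty Y]
  [Fintype A] [Nonempty A] [MeasurableSpace A] [MeasurableSingletonClass A]

instance isProbabilityMeasure_induced (G : ConversationGame k A XA XB Y M)
    (CB : Fin k → BobRule K XB M) (CA : AliceRule k K XA M) (DA : DecisionRule k K A XA M) :
    IsProbabilityMeasure (G.induced CB CA DA) :=
  Measure.isProbabilityMeasure_map (Measurable.aemeasurable (by fun_prop))

instance isProbabilityMeasure_inducedQ (G : ConversationGame k A XA XB Y M) (l : ℝ)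
    (CB : Fin k → BobRule K XB M) : IsProbabilityMeasure (G.inducedQ l CB) := by
  unfold inducedQ
  infer_instance

/-- Conditionally on the final state the action is a softmax draw, so integrating it out leaves a
functional of the belief vector alone; replacing that vector by the full-information one then
settles the payoff of every player. -/
theorem integral_induced_quantalRule (G : ConversationGame k A XA XB Y M) (l : ℝ)
    (CB : Fin k → BobRule K XB M) (CA : AliceRule k K XA M) {v : A → Y → unitInterval}
    (hv : ∀ a, Measurable (v a)) :
    ∫ p, (v p.1 p.2 : ℝ) ∂(G.induced CB CA (G.quantalRule l CB CA))
      = ∫ s, ∑ a, softmax l (fun a => (G.belief (G.law CB CA K le_rfl) (s.1, s.2.2.2) a : ℝ)) a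
          * (v a s.2.2.1 : ℝ) ∂(G.law CB CA K le_rfl : Measure (State k XA XB Y M K)) := by
  have hv' : Measurable fun p : A × Y => v p.1 p.2 := measurable_from_prod_countable_right hv
  rw [induced, integral_map (by fun_prop) (by fun_prop), Measure.integral_compProd]
  · refine integral_congr_ae (Filter.Eventually.of_forall fun s => ?_)
    exact integral_softmaxKernel l (fun x a => (G.belief (G.law CB CA K le_rfl) x a : ℝ))
      (measurable_pi_lambda _ fun a =>
        ((measurable_pi_apply a).comp (G.measurable_belief _)).subtype_val) (s.1, s.2.2.2) _
  · exact integrable_comp_unitInterval _ (hv'.comp (f := fun p : State k XA XB Y M K × A =>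
      (p.2, p.1.2.2.1)) (by fun_prop))

/-- A single Bob who reveals the features of the Bobs makes Alice respond to full information. -/
theorem integral_inducedQ_update_reveal [StandardBorelSpace XB]
    (G : ConversationGame k A XA XB Y M) (l : ℝ) (hK : 1 ≤ K) (CB : Fin k → BobRule K XB M)
    {e : XB → M} (he : Measurable e) {d : M → XB} (hd : Measurable d) (hde : ∀ x, d (e x) = x)
    (i : Fin k) {v : A → Y → unitInterval} (hv : ∀ a, Measurable (v a)) :
    ∫ p, (v p.1 p.2 : ℝ) ∂(G.inducedQ l (Function.update CB i (BobRule.reveal K he)))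
      = G.fullInformationValue l v := by
  -- At least one round is needed for the revealing message; writing `K = r + 1` names the last one.
  obtain ⟨r, rfl⟩ := Nat.exists_eq_succ_of_ne_zero (Nat.one_le_iff_ne_zero.1 hK)
  set CB' := Function.update CB i (BobRule.reveal (r + 1) he)
  have hrev := ae_law_reveal G CB' (G.straightforwardRule CB') he hd hde i
    (Function.update_self ..)
  have hbel := belief_ae_eq_fullBelief G CB' (G.straightforwardRule CB') (r + 1) le_rfl
    (D := fun t => d (t i (Fin.last r)).2) (by fun_prop) hrev
  rw [inducedQ, integral_induced_quantalRule G l CB' _ hv, fullInformationValue,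
    -- The prior is the marginal of the law of the conversation, so both sides become integrals over
    -- the same final state and can be compared almost everywhere.
    ← map_law_instance G CB' (G.straightforwardRule CB') (r + 1) le_rfl, integral_map]
  · refine integral_congr_ae ?_
    filter_upwards [hbel] with s hs
    simp only [hs]
  · fun_prop
  · refine Measurable.aestronglyMeasurable
      (Finset.measurable_fun_sum _ fun a _ => Measurable.mul ?_ ?_)
    · exact (measurable_softmax l a).comp (G.measurable_fullBelief.comp (by fun_prop))
    · exact ((hv a).comp (by fun_prop)).subtype_val

/-- In equilibrium Alice loses nothing beyond misalignment and the noise of her responses: a Bob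
may reveal the features of the Bobs, and every such deviation induces the same law of `(a, y)`.
The bound needs no assumption on the prior. -/
theorem IsQuantalResponseNash.firstBest_le [StandardBorelSpace XB]
    {G : ConversationGame k A XA XB Y M} {l : ℝ} (hl : 0 < l) (hK : 1 ≤ K)
    {CB : Fin k → BobRule K XB M} (hNE : G.IsQuantalResponseNash l CB) {ε : ℝ}
    (halign : G.WeightedAligned ε) :
    G.firstBest - 2 * ε - Real.log (Fintype.card A) / l
      ≤ ∫ p, (G.uA p.1 p.2 : ℝ) ∂(G.inducedQ l CB) := by
  obtain ⟨w, c, hw, hw1, h⟩ := halign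
  -- A reference deviator, whose identity is irrelevant. One exists because an empty family of
  -- weights would sum to `0`.
  obtain ⟨i₀⟩ : Nonempty (Fin k) := by
    by_contra hk
    rw [not_nonempty_iff] at hk
    simp at hw1
  have hXB : Nonempty XB := (nonempty_of_isProbabilityMeasure
    (G.prior : Measure (XA × XB × Y))).map fun ω => ω.2.1
  obtain ⟨e, d, he, hd, hde⟩ := G.exists_measurable_leftInverse
  have hdev := fun (i : Fin k) (v : A → Y → unitInterval) (hv : ∀ a, Measurable (v a)) =>
    G.integral_inducedQ_update_reveal l hK CB he hd hde i hv
  have h1 := (abs_le.1 (G.abs_sum_integral_sub_le h (G.inducedQ l CB))).2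
  have h2 := (abs_le.1 (G.abs_sum_integral_sub_le h
    (G.inducedQ l (Function.update CB i₀ (BobRule.reveal K he))))).1
  rw [hdev i₀ _ G.measurable_uA] at h2
  have h3 : ∑ i, w i * ∫ p, (G.U i p.1 p.2 : ℝ)
        ∂(G.inducedQ l (Function.update CB i₀ (BobRule.reveal K he)))
      ≤ ∑ i, w i * ∫ p, (G.U i p.1 p.2 : ℝ) ∂(G.inducedQ l CB) := by
    refine Finset.sum_le_sum fun i _ => mul_le_mul_of_nonneg_left ?_ (hw i)
    -- The exchange of deviators: the value of `U_i` when `i₀` reveals equals its value when `i`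
    -- himself reveals, and the latter is what the equilibrium condition of Bob `i` bounds.
    rw [hdev i₀ _ (G.measurable_U i), ← hdev i _ (G.measurable_U i)]
    exact hNE i (BobRule.reveal K he)
  -- In the final sum `c` cancels between `h1` and `h2`, each of which contributes one `ε`.
  have h4 := G.firstBest_sub_le_fullInformationValue hl
  linarith

end

end ConversationGame

theorem mainTheorem1 {k K : ℕ} {A XA XB Y M : Type*}
    [Fintype A] [Nonempty A] [MeasurableSpace A] [MeasurableSingletonClass A]
    [MeasurableSpace XA] [StandardBorelSpace XA] [MeasurableSpace XB] [StandardBorelSpace XB]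
    [MeasurableSpace Y] [StandardBorelSpace Y] [Nonempty Y] [MeasurableSpace M]
    (G : ConversationGame k A XA XB Y M) (hsub : G.InformationSubstitutes)
    (ε : ℝ) (halign : G.WeightedAligned ε)
    (lam : ℝ) (hlam : 0 < lam) (hK : 1 ≤ K)
    (δconv : ℝ) (hδ0 : 0 < δconv) (hδ1 : δconv < 1)
    (ζ : ℝ) (hζ : ζ = (3 * (Fintype.card A : ℝ) / ((K : ℝ) * δconv)) ^ (1 / 2 : ℝ))
    (CB : Fin k → ConversationGame.BobRule K XB M) (hNE : G.IsQuantalResponseNash lam CB) :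
    G.firstBest - 2 * ε
        - (2 * (10 * ζ ^ (1 / 3 : ℝ) + δconv)
            + Real.exp (4 * lam * (10 * ζ ^ (1 / 3 : ℝ))) - 1 + δconv)
        - Real.log (Fintype.card A) / lam
      ≤ ∫ p, (G.uA p.1 p.2 : ℝ) ∂(G.inducedQ lam CB) := by
  have h := ConversationGame.IsQuantalResponseNash.firstBest_le hlam hK hNE halign
  have hζ0 : 0 ≤ ζ := hζ ▸ Real.rpow_nonneg (by positivity) _
  have hz : 0 ≤ ζ ^ (1 / 3 : ℝ) := Real.rpow_nonneg hζ0 _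
  -- The exponential is at least `1`, so the bracketed error is nonnegative and subtracting it only
  -- weakens the equilibrium bound `h`.
  have hexp : 1 ≤ Real.exp (4 * lam * (10 * ζ ^ (1 / 3 : ℝ))) := Real.one_le_exp (by positivity)
  linarith
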